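/- Let $\mathfrak H$ be a complex Hilbert space and let $A$, $B$ be positive-definite self-adjoint operators in $\mathfrak H$ (self-adjoint, with $(Ax,x)\ge\gamma\|x\|^2$ on $\mathcal D(A)$ for some $\gamma>0$, and likewise for $B$) such that $\mathcal D(A)=\mathcal D(B)$. Suppose that $B$ has discrete simple spectrum: there is an orthonormal basis $\{e_k\}_{k\ge1}$ of $\mathfrak H$ with $Be_k=\lambda_ke_k$ and $0<\lambda_1<\lambda_2<\cdots$, $\lambda_k\to\infty$. For $x\in\mathcal D(A)$ put $\|x\|_+=(Ax,x)^{1/2}$. Then the operators $B^{1/2}A^{-1/2}$ and $A^{1/2}B^{-1/2}$ are defined and bounded on all of $\mathfrak H$. Put $\mathbf c_1=\|B^{1/2}A^{-1/2}\|$, $\mathbf c_2=\|A^{1/2}B^{-1/2}\|$, $\mathbf c_3=\mathbf c_1\mathbf c_2$ and $\mathbf c_0=\mathbf c_2\mathbf c_3$. Let $y\in\mathfrak H$, let $x\in\mathcal D(A)$ be the solution of $Ax=y$, and let $x_n$ be its Ritz approximations with respect to the coordinate system $\{e_k\}$, that is, $x_n$ minimizes $F(z)=(Az,z)-2\operatorname{Re}(y,z)$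 over the linear span of $e_1,\dots,e_n$. If $x\in\mathcal D(B^\alpha)$ with $\alpha\ge1$, then for all $k,n\in\mathbb N$ $$\|x-x_n\|_+\le \mathbf c_0\,\frac{\sqrt{k+1}}{2^k\,\lambda_{n+1}^{\alpha-1/2}}\;\omega_k\!\left(\frac{\pi}{\lambda_{n+1}},B^\alpha x,B\right),$$ where $\omega_k(t,u,B)=\sup_{0<\tau\le t}\|(e^{i\tau B}-I)^ku\|$. Moreover, $\lambda_{n+1}^{\alpha-1/2}\|x-x_n\|_+\to0$ as $n\to\infty$. -/

import Mathlib

open Filter Topology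
open scoped InnerProductSpace

noncomputable section

namespace RitzApprox

variable {H : Type*} [NormedAddCommGroup H] [InnerProductSpace ℂ H]

/-- The product `T S` of two unbounded operators on its natural domain
`{x ∈ D(S) | S x ∈ D(T)}`. -/
def opComp (T S : H →ₗ.[ℂ] H) : H →ₗ.[ℂ] H where
  domain := (T.domain.comap S.toFun).map S.domain.subtype
  toFun :=
    { toFun := fun x => T ⟨S ⟨x, by obtain ⟨u, -, hu⟩ := x.2; exact hu ▸ u.2⟩, by
        obtain ⟨x, u, hu, rfl⟩ := x
        exact hu⟩
      map_add' := by
        rintro ⟨x, u, hu, rfl⟩ ⟨y, v, hv, rfl⟩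
        rw [← LinearPMap.map_add]
        congr 1
        ext
        exact LinearPMap.map_add S u v
      map_smul' := by
        rintro c ⟨x, u, hu, rfl⟩
        rw [RingHom.id_apply, ← LinearPMap.map_smul]
        congr 1
        ext
        exact LinearPMap.map_smul S c u }

section PositiveDefinite

variable [CompleteSpace H]

/-- A positive-definite self-adjoint operator: `A = A*` and `(A x, x) ≥ γ ‖x‖²` on `D(A)` for
some `γ > 0`. -/
structure IsPosDefSelfAdjoint (A : H →ₗ.[ℂ] H) : Prop where
  selfAdjoint : IsSelfAdjoint A
  lower_bound : ∃ γ : ℝ, 0 < γ ∧ ∀ x : A.domain, γ * ‖(x : H)‖ ^ 2 ≤ (⟪A x, (x : H)⟫_ℂ).re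

namespace IsPosDefSelfAdjoint

variable {A : H →ₗ.[ℂ] H}

theorem symm (hA : IsPosDefSelfAdjoint A) (x y : A.domain) :
    ⟪A x, (y : H)⟫_ℂ = ⟪(x : H), A y⟫_ℂ := by
  have h := LinearPMap.adjoint_isFormalAdjoint hA.selfAdjoint.dense_domain
  have e : A.adjoint = A := hA.selfAdjoint
  rw [e] at h
  exact h x y

/-- A positive-definite self-adjoint operator has a bounded everywhere defined inverse. -/
theorem exists_inverse (hA : IsPosDefSelfAdjoint A) :
    ∃ T : H →L[ℂ] H, ∀ y : H, ∃ h : T y ∈ A.domain, A ⟨T y, h⟩ = y := by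
  obtain ⟨γ, hγ, hb⟩ := hA.lower_bound
  have hnorm : ∀ x : A.domain, γ * ‖(x : H)‖ ≤ ‖A x‖ := by
    intro x
    have h1 := hb x
    have h2 : (⟪A x, (x : H)⟫_ℂ).re ≤ ‖A x‖ * ‖(x : H)‖ := re_inner_le_norm (𝕜 := ℂ) _ _
    rcases (norm_nonneg (x : H)).eq_or_lt with h0 | h0
    · rw [← h0, mul_zero]; exact norm_nonneg _
    · nlinarith
  have hinj : Function.Injective A.toFun := by
    rw [← LinearMap.ker_eq_bot, LinearMap.ker_eq_bot']
    intro x hx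
    have h1 := hnorm x
    rw [show A x = 0 from hx, norm_zero] at h1
    have : ‖(x : H)‖ ≤ 0 := by
      by_contra h
      push Not at h
      nlinarith
    exact Subtype.ext (norm_le_zero_iff.mp this)
  have hcl : IsClosed ((LinearMap.range A.toFun : Submodule ℂ H) : Set H) := by
    apply IsSeqClosed.isClosed
    intro u y hu hy
    choose v hv using hu
    have hcv : CauchySeq (fun n => (v n : H)) := by
      have hc := hy.cauchySeq
      rw [Metric.cauchySeq_iff'] at hc ⊢
      intro ε hε
      obtain ⟨N, hN⟩ := hc (γ * ε) (mul_pos hγ hε)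
      refine ⟨N, fun n hn => ?_⟩
      have h1 := hN n hn
      have h2 := hnorm (v n - v N)
      have h3 : A (v n - v N) = u n - u N := by
        rw [LinearPMap.map_sub]; exact congrArg₂ _ (hv n) (hv N)
      rw [h3] at h2
      rw [dist_eq_norm] at h1 ⊢
      have h4 : γ * ‖(v n : H) - v N‖ < γ * ε := lt_of_le_of_lt h2 h1
      exact lt_of_mul_lt_mul_left h4 hγ.le
    obtain ⟨x, hx⟩ := cauchySeq_tendsto_of_complete hcv
    have hg : (x, y) ∈ A.graph := by
      have hc : IsClosed (A.graph : Set (H × H)) := hA.selfAdjoint.isClosed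
      refine hc.mem_of_tendsto (hx.prodMk_nhds hy) (Eventually.of_forall fun n => ?_)
      rw [← hv n]
      exact LinearPMap.mem_graph A (v n)
    obtain ⟨w, hw, hw'⟩ := (LinearPMap.mem_graph_iff A).mp hg
    exact ⟨w, hw'⟩
  have hsurj : Function.Surjective A.toFun := by
    rw [← LinearMap.range_eq_top]
    have : (LinearMap.range A.toFun : Submodule ℂ H).HasOrthogonalProjection := by
      have := hcl.completeSpace_coe
      infer_instance
    rw [← Submodule.orthogonal_eq_bot_iff, Submodule.eq_bot_iff]
    intro y hy
    have hy' : ∀ x : A.domain, ⟪(0 : H), (x : H)⟫_ℂ = ⟪y, A x⟫_ℂ := by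
      intro x
      rw [inner_zero_left]
      exact (Submodule.inner_left_of_mem_orthogonal (LinearMap.mem_range_self A.toFun x) hy).symm
    have e : A.adjoint = A := hA.selfAdjoint
    have hmem : y ∈ A.adjoint.domain := LinearPMap.mem_adjoint_domain_of_exists y ⟨0, hy'⟩
    have h0 : A.adjoint ⟨y, hmem⟩ = 0 :=
      LinearPMap.adjoint_apply_eq hA.selfAdjoint.dense_domain _ hy'
    have key : ∀ S : H →ₗ.[ℂ] H, S = A → ∀ h : y ∈ S.domain, S ⟨y, h⟩ = 0 → y = 0 := by
      rintro S rfl h hz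
      have := hnorm ⟨y, h⟩
      rw [hz, norm_zero] at this
      by_contra hne
      have : 0 < γ * ‖y‖ := mul_pos hγ (norm_pos_iff.mpr hne)
      simp only at *
      linarith
    exact key _ e hmem h0
  let E : A.domain ≃ₗ[ℂ] H := LinearEquiv.ofBijective A.toFun ⟨hinj, hsurj⟩
  have hE : ∀ y, A (E.symm y) = y := fun y => E.apply_symm_apply y
  refine ⟨(A.domain.subtype ∘ₗ E.symm.toLinearMap).mkContinuous γ⁻¹ ?_, fun y => ?_⟩
  · intro y
    have := hnorm (E.symm y)
    rw [hE] at this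
    rw [inv_mul_eq_div, le_div_iff₀' hγ]
    exact this
  · exact ⟨(E.symm y).2, hE y⟩

/-- The bounded inverse `A⁻¹` of a positive-definite self-adjoint operator. -/
def inv (hA : IsPosDefSelfAdjoint A) : H →L[ℂ] H := hA.exists_inverse.choose

theorem inv_mem (hA : IsPosDefSelfAdjoint A) (y : H) : hA.inv y ∈ A.domain :=
  (hA.exists_inverse.choose_spec y).1

theorem apply_inv (hA : IsPosDefSelfAdjoint A) (y : H) : A ⟨hA.inv y, hA.inv_mem y⟩ = y :=
  (hA.exists_inverse.choose_spec y).2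

theorem inv_nonneg (hA : IsPosDefSelfAdjoint A) : 0 ≤ hA.inv := by
  rw [ContinuousLinearMap.nonneg_iff_isPositive, ContinuousLinearMap.isPositive_def']
  obtain ⟨γ, hγ, hb⟩ := hA.lower_bound
  refine ⟨?_, fun y => ?_⟩
  · rw [ContinuousLinearMap.isSelfAdjoint_iff_isSymmetric]
    intro x y
    have := hA.symm ⟨hA.inv x, hA.inv_mem x⟩ ⟨hA.inv y, hA.inv_mem y⟩
    rw [apply_inv, apply_inv] at this
    exact this.symm
  · have h := hb ⟨hA.inv y, hA.inv_mem y⟩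
    rw [apply_inv, ← inner_conj_symm, Complex.conj_re] at h
    exact le_trans (by positivity) h

/-- `A^{-1/2}`: the nonnegative square root of the bounded operator `A⁻¹`. -/
def invSqrt (hA : IsPosDefSelfAdjoint A) : H →L[ℂ] H := CFC.sqrt hA.inv

theorem ker_invSqrt (hA : IsPosDefSelfAdjoint A) : LinearMap.ker (hA.invSqrt : H →ₗ[ℂ] H) = ⊥ := by
  rw [LinearMap.ker_eq_bot']
  intro x hx
  have h1 : hA.inv x = 0 := by
    rw [← CFC.sqrt_mul_sqrt_self hA.inv hA.inv_nonneg]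
    change hA.invSqrt (hA.invSqrt x) = 0
    rw [show hA.invSqrt x = 0 from hx, map_zero]
  rw [← hA.apply_inv x]
  have : (⟨hA.inv x, hA.inv_mem x⟩ : A.domain) = 0 := Subtype.ext h1
  rw [this, LinearPMap.map_zero]

/-- The unbounded operator `A^{1/2} = (A^{-1/2})⁻¹`, with domain the range of `A^{-1/2}`. -/
def sqrt (hA : IsPosDefSelfAdjoint A) : H →ₗ.[ℂ] H :=
  ((hA.invSqrt : H →ₗ[ℂ] H).toPMap ⊤).inverse

end IsPosDefSelfAdjoint

end PositiveDefinite

/-- `B` has discrete simple spectrum: there is an orthonormal basis `e_k` (numbered from `0`) of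
eigenvectors, `B e_k = λ_k e_k`, with `λ_0 < λ_1 < ⋯ → ∞`. -/
structure SimpleDiscreteSpectrum (B : H →ₗ.[ℂ] H) where
  basis : HilbertBasis ℕ ℂ H
  eigenvalue : ℕ → ℝ
  basis_mem : ∀ k, basis k ∈ B.domain
  apply_basis : ∀ k, B ⟨basis k, basis_mem k⟩ = (eigenvalue k : ℂ) • basis k
  strictMono : StrictMono eigenvalue
  tendsto : Tendsto eigenvalue atTop atTop

namespace SimpleDiscreteSpectrum

variable {B : H →ₗ.[ℂ] H} (S : SimpleDiscreteSpectrum B)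

/-- The domain `{x | ∑ |G(λ_k)|² |(x, e_k)|² < ∞}` of `G(B)`. -/
def funcDomain (G : ℝ → ℂ) : Submodule ℂ H where
  carrier := {x | Memℓp (fun k => G (S.eigenvalue k) * S.basis.repr x k) 2}
  zero_mem' := by
    have h : (fun k => G (S.eigenvalue k) * S.basis.repr (0 : H) k) = 0 := by
      funext k
      simp
    change Memℓp _ 2
    rw [h]
    exact zero_memℓp
  add_mem' := by
    intro x y hx hy
    have h : (fun k => G (S.eigenvalue k) * S.basis.repr (x + y) k) =
        (fun k => G (S.eigenvalue k) * S.basis.repr x k) +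
          fun k => G (S.eigenvalue k) * S.basis.repr y k := by
      funext k
      simp [mul_add]
    change Memℓp _ 2
    rw [h]
    exact Memℓp.add hx hy
  smul_mem' := by
    intro c x hx
    have h : (fun k => G (S.eigenvalue k) * S.basis.repr (c • x) k) =
        c • fun k => G (S.eigenvalue k) * S.basis.repr x k := by
      funext k
      simp [mul_left_comm]
    change Memℓp _ 2
    rw [h]
    exact Memℓp.const_smul hx c

/-- The sequence of coefficients `G(λ_k) (x, e_k)` of `G(B) x`. -/
def funcCoeff (G : ℝ → ℂ) (x : S.funcDomain G) : lp (fun _ : ℕ => ℂ) 2 :=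
  ⟨fun k => G (S.eigenvalue k) * S.basis.repr (x : H) k, x.2⟩

theorem funcCoeff_apply (G : ℝ → ℂ) (x : S.funcDomain G) (k : ℕ) :
    S.funcCoeff G x k = G (S.eigenvalue k) * S.basis.repr (x : H) k := rfl

/-- The operator `G(B) = ∫ G(λ) dE(λ)`, where `E(Δ) x = ∑_{λ_k ∈ Δ} (x, e_k) e_k` is the spectral
measure of `B`: its domain consists of the `x` with `∑ |G(λ_k)|² |(x, e_k)|² < ∞`, and
`G(B) x = ∑ G(λ_k) (x, e_k) e_k`. -/
def func (G : ℝ → ℂ) : H →ₗ.[ℂ] H where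
  domain := S.funcDomain G
  toFun :=
    { toFun := fun x => S.basis.repr.symm (S.funcCoeff G x)
      map_add' := by
        intro x y
        rw [← map_add]
        congr 1
        ext k
        rw [lp.coeFn_add, Pi.add_apply]
        simp only [funcCoeff_apply, Submodule.coe_add, map_add, lp.coeFn_add, Pi.add_apply, mul_add]
      map_smul' := by
        intro c x
        rw [RingHom.id_apply, ← map_smul]
        congr 1
        ext k
        rw [lp.coeFn_smul, Pi.smul_apply]
        simp only [funcCoeff_apply, Submodule.coe_smul, map_smul, lp.coeFn_smul, Pi.smul_apply,
          smul_eq_mul, mul_left_comm] }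

theorem norm_exp_mul (h t : ℝ) (z : ℂ) : ‖Complex.exp (h * t * Complex.I) * z‖ = ‖z‖ := by
  rw [norm_mul, ← Complex.ofReal_mul, Complex.norm_exp_ofReal_mul_I, one_mul]

theorem mem_exp_domain (h : ℝ) (x : H) :
    x ∈ (S.func fun t => Complex.exp (h * t * Complex.I)).domain := by
  refine memℓp_norm_iff.mp ?_
  simp only [norm_exp_mul]
  exact memℓp_norm_iff.mpr (lp.memℓp (S.basis.repr x))

/-- `B ^ s = ∫ λ ^ s dE(λ)` (for positive-definite `B`, so that all `λ_k > 0`). -/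
def power (s : ℝ) : H →ₗ.[ℂ] H := S.func fun t => ((t ^ s : ℝ) : ℂ)

/-- The unitary operator `U(h) = exp(i h B) = ∫ exp(i h λ) dE(λ)`, which is everywhere defined. -/
def unitaryGroup (h : ℝ) : H →L[ℂ] H :=
  ((S.func fun t => Complex.exp (h * t * Complex.I)).toFun ∘ₗ
    LinearMap.codRestrict _ LinearMap.id (S.mem_exp_domain h)).mkContinuous 1 (by
      intro x
      rw [one_mul]
      change ‖S.basis.repr.symm _‖ ≤ ‖x‖
      rw [LinearIsometryEquiv.norm_map, ← S.basis.repr.norm_map x]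
      exact lp.norm_mono (by norm_num) fun k => (norm_exp_mul _ _ _).le)

/-- The `k`-th difference `Δ_h^k x = (U(h) - I)^k x`. -/
def diff (k : ℕ) (h : ℝ) (x : H) : H := ((S.unitaryGroup h - 1) ^ k) x

/-- The `k`-th modulus of continuity `ω_k(t, x, B) = sup_{0 < τ ≤ t} ‖Δ_τ^k x‖`. -/
def modulus (k : ℕ) (t : ℝ) (x : H) : ℝ := ⨆ τ : Set.Ioc (0 : ℝ) t, ‖S.diff k τ x‖

end SimpleDiscreteSpectrum

/-- The energy norm `‖x‖₊ = (A x, x)^{1/2}` on `D(A)`. -/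
def energyNorm (A : H →ₗ.[ℂ] H) (x : A.domain) : ℝ := √(⟪A x, (x : H)⟫_ℂ).re

/-- The functional `F(z) = (A z, z) - 2 Re (y, z)` on `D(A)`. -/
def ritzFunctional (A : H →ₗ.[ℂ] H) (y : H) (z : A.domain) : ℝ :=
  (⟪A z, (z : H)⟫_ℂ).re - 2 * (⟪y, (z : H)⟫_ℂ).re

/-- `z` is the `n`-th Ritz approximate solution of `A x = y` for the coordinate system `e`: it
minimizes `F` over the elements of `D(A)` in the span of the first `n` vectors of `e`. -/
def IsRitzSolution (A : H →ₗ.[ℂ] H) (y : H) (e : ℕ → H) (n : ℕ) (z : A.domain) : Prop :=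
  (z : H) ∈ Submodule.span ℂ (e '' Set.Iio n) ∧
    IsMinOn (ritzFunctional A y)
      {w : A.domain | (w : H) ∈ Submodule.span ℂ (e '' Set.Iio n)} z

end RitzApprox

end

open Filter Topology
open scoped InnerProductSpace

noncomputable section

/-! The Ritz approximation is the best energy-norm approximation from the span, so it is at least as
good as the partial sum of `x` in the eigenbasis. `‖C₂‖` bounds the energy norm of `A` by that of
`B`, and in the eigenbasis the tail of `x` has `B`-energy norm at most `λ_n ^ (1/2 - α)` times the
tail norm of `u = B ^ α x`. This already gives the limit.

The rate needs a Jackson inequality for that tail (`sum_norm_repr_sq_le_modulus`). By Parseval,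
`‖Δ_τ^k u‖²` is the sum of `(2 (1 - cos (τ λ_j))) ^ k |u_j|²`. Putting `τ = t / λ_n` and integrating
against `sin t` over `[0, π]` leaves moments with `s = λ_j / λ_n ≥ 1` on the tail, bounded below in
`le_sineMoment`.

The bounded factors come from `exists_invSqrt_eq_invSqrt_comp`: equality of domains compares `A⁻²`
with `B⁻²`, and operator monotonicity of the square root passes to `A⁻¹` and `B⁻¹`. -/

namespace RitzApprox

/-! ### Lower bounds for trigonometric moments -/

section Integral

open intervalIntegral

/-- The moments `∫₀^π (1 - cos (s t)) ^ k sin t dt`. -/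
def sineMoment (s : ℝ) (k : ℕ) : ℝ := ∫ t in (0 : ℝ)..Real.pi, (1 - Real.cos (s * t)) ^ k * Real.sin t

theorem hasDerivAt_one_sub_cos_mul (s t : ℝ) :
    HasDerivAt (fun t => 1 - Real.cos (s * t)) (s * Real.sin (s * t)) t := by
  have h : HasDerivAt (fun t => s * t) s t := by simpa using (hasDerivAt_id t).const_mul s
  simpa [mul_comm] using (h.cos.const_sub 1)

theorem sineMoment_zero (s : ℝ) : sineMoment s 0 = 2 := by
  simp [sineMoment, integral_sin]; norm_num

theorem sineMoment_one (k : ℕ) : sineMoment 1 k = 2 ^ (k + 1) / (k + 1) := by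
  have h : ∀ t ∈ Set.uIcc 0 Real.pi, HasDerivAt
      (fun t => (1 - Real.cos (1 * t)) ^ (k + 1) / ((k : ℝ) + 1))
      ((1 - Real.cos (1 * t)) ^ k * Real.sin t) t := by
    intro t _
    have := ((hasDerivAt_one_sub_cos_mul 1 t).pow (k + 1)).div_const ((k : ℝ) + 1)
    refine this.congr_deriv ?_
    have : (k : ℝ) + 1 ≠ 0 := by positivity
    simp only [Nat.add_sub_cancel, one_mul]
    push_cast
    field_simp
  rw [sineMoment, integral_eq_sub_of_hasDerivAt h (Continuous.intervalIntegrable (by fun_prop) _ _)]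
  simp
  norm_num

/-- Integrating by parts twice gives a two-term recursion for the moments. -/
theorem sineMoment_succ (s : ℝ) (k : ℕ) :
    ((k + 1) ^ 2 * s ^ 2 - 1) * sineMoment s (k + 1) =
      s ^ 2 * ((k + 1) * (2 * k + 1)) * sineMoment s k -
        (1 - Real.cos (Real.pi * s)) ^ (k + 1) := by
  have h : ∀ t ∈ Set.uIcc 0 Real.pi, HasDerivAt
      (fun t => (k + 1) * (1 - Real.cos (s * t)) ^ k * (s * Real.sin (s * t)) * Real.sin t
        - (1 - Real.cos (s * t)) ^ (k + 1) * Real.cos t)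
      (s ^ 2 * ((k + 1) * (2 * k + 1)) * ((1 - Real.cos (s * t)) ^ k * Real.sin t) -
        ((k + 1) ^ 2 * s ^ 2 - 1) * ((1 - Real.cos (s * t)) ^ (k + 1) * Real.sin t)) t := by
    intro t _
    have hv := hasDerivAt_one_sub_cos_mul s t
    have hs : HasDerivAt (fun t => s * Real.sin (s * t)) (s * (Real.cos (s * t) * s)) t := by
      have h : HasDerivAt (fun t => s * t) s t := by simpa using (hasDerivAt_id t).const_mul s
      exact h.sin.const_mul s
    have := ((((hv.pow k).const_mul ((k : ℝ) + 1)).mul hs).mul (Real.hasDerivAt_sin t)).sub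
      ((hv.pow (k + 1)).mul (Real.hasDerivAt_cos t))
    refine this.congr_deriv ?_
    have hsq : Real.sin (s * t) ^ 2 = 1 - Real.cos (s * t) ^ 2 := by
      rw [← Real.sin_sq_add_cos_sq (s * t)]; ring
    -- `sin² = (1 - cos)(1 + cos)` restores the power lost in differentiating; `k = 0` is separate
    -- because `k - 1` truncates.
    have hk : (k : ℝ) * (1 - Real.cos (s * t)) ^ (k - 1) * Real.sin (s * t) ^ 2 =
        k * (1 - Real.cos (s * t)) ^ k * (1 + Real.cos (s * t)) := by
      rw [hsq]
      rcases k with _ | k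
      · simp
      · simp only [Nat.add_sub_cancel]; ring
    simp only [Nat.add_sub_cancel, Pi.pow_apply, Pi.mul_apply]
    push_cast
    linear_combination ((k : ℝ) + 1) * s ^ 2 * Real.sin t * hk
  have hi := integral_eq_sub_of_hasDerivAt h (Continuous.intervalIntegrable (by fun_prop) _ _)
  rw [integral_sub (Continuous.intervalIntegrable (by fun_prop) _ _)
    (Continuous.intervalIntegrable (by fun_prop) _ _), integral_const_mul, integral_const_mul] at hi
  simp at hi
  rw [sineMoment, sineMoment, mul_comm Real.pi s]
  linarith

/-- Induction on `k` through the recursion, with boundary term at most `2 ^ (k + 1)`. The case `s =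
1` is computed exactly, since there the leading coefficient of the recursion vanishes at `k = 0`. -/
theorem le_sineMoment {s : ℝ} (hs : 1 ≤ s) (k : ℕ) : 2 ^ (k + 1) / (k + 1) ≤ sineMoment s k := by
  rcases hs.eq_or_lt with rfl | hs
  · exact (sineMoment_one k).ge
  induction k with
  | zero => simp [sineMoment_zero]
  | succ k ih =>
    have h := sineMoment_succ s k
    have hk : (0 : ℝ) ≤ k := k.cast_nonneg
    have hs2 : 1 < s ^ 2 := by nlinarith
    have hpos : 0 < ((k : ℝ) + 1) ^ 2 * s ^ 2 - 1 := by nlinarith [sq_nonneg (k : ℝ)]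
    have hV : (1 - Real.cos (Real.pi * s)) ^ (k + 1) ≤ 2 ^ (k + 1) :=
      pow_le_pow_left₀ (by linarith [Real.cos_le_one (Real.pi * s)])
        (by linarith [Real.neg_one_le_cos (Real.pi * s)]) _
    refine le_of_mul_le_mul_left ?_ hpos
    rw [h]
    have h1 := mul_le_mul_of_nonneg_left ih
      (show 0 ≤ s ^ 2 * (((k : ℝ) + 1) * (2 * k + 1)) by positivity)
    refine le_trans ?_ (sub_le_sub h1 hV)
    -- The slack in the induction step is a nonnegative multiple of `s ^ 2 - 1`.
    have e : s ^ 2 * (((k : ℝ) + 1) * (2 * k + 1)) * (2 ^ (k + 1) / (k + 1)) - 2 ^ (k + 1) -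
        (((k : ℝ) + 1) ^ 2 * s ^ 2 - 1) * (2 ^ (k + 1 + 1) / ((k + 1 : ℕ) + 1)) =
        (s ^ 2 - 1) * (2 ^ (k + 1) * k / (k + 2)) := by
      push_cast
      field_simp
      ring
    have : 0 ≤ (s ^ 2 - 1) * (2 ^ (k + 1) * (k : ℝ) / (k + 2)) :=
      mul_nonneg (by linarith) (by positivity)
    linarith

end Integral

variable {H : Type*} [NormedAddCommGroup H] [InnerProductSpace ℂ H]

/-! ### Comparison of square roots and energy norms -/

section PositiveDefinite

variable [CompleteSpace H]

namespace IsPosDefSelfAdjoint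

variable {A B : H →ₗ.[ℂ] H}

theorem eq_zero_of_apply_eq_zero (hA : IsPosDefSelfAdjoint A) {x : A.domain} (hx : A x = 0) :
    x = 0 := by
  obtain ⟨γ, hγ, hb⟩ := hA.lower_bound
  have h := hb x
  rw [hx, inner_zero_left, Complex.zero_re] at h
  have : ‖(x : H)‖ ^ 2 ≤ 0 := by
    by_contra h'
    push Not at h'
    linarith [mul_pos hγ h']
  exact Subtype.ext (norm_eq_zero.mp (pow_eq_zero_iff two_ne_zero |>.mp
    (le_antisymm this (sq_nonneg _))))

theorem inv_apply (hA : IsPosDefSelfAdjoint A) (x : A.domain) : hA.inv (A x) = x := by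
  have : (⟨hA.inv (A x), hA.inv_mem _⟩ : A.domain) - x = 0 :=
    hA.eq_zero_of_apply_eq_zero (by rw [LinearPMap.map_sub, hA.apply_inv, sub_self])
  exact congrArg Subtype.val (sub_eq_zero.mp this)

theorem inv_injective (hA : IsPosDefSelfAdjoint A) : Function.Injective hA.inv := by
  intro x y h
  rw [← hA.apply_inv x, ← hA.apply_inv y]
  congr 1
  exact Subtype.ext h

theorem invSqrt_invSqrt (hA : IsPosDefSelfAdjoint A) (x : H) :
    hA.invSqrt (hA.invSqrt x) = hA.inv x := by
  conv_rhs => rw [← CFC.sqrt_mul_sqrt_self hA.inv hA.inv_nonneg]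
  rfl

theorem isSelfAdjoint_inv (hA : IsPosDefSelfAdjoint A) : IsSelfAdjoint hA.inv :=
  IsSelfAdjoint.of_nonneg hA.inv_nonneg

theorem isSelfAdjoint_invSqrt (hA : IsPosDefSelfAdjoint A) : IsSelfAdjoint hA.invSqrt :=
  IsSelfAdjoint.of_nonneg (CFC.sqrt_nonneg hA.inv)

theorem invSqrt_injective (hA : IsPosDefSelfAdjoint A) : Function.Injective hA.invSqrt :=
  LinearMap.ker_eq_bot.mp hA.ker_invSqrt

theorem inner_invSqrt_left (hA : IsPosDefSelfAdjoint A) (x y : H) :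
    ⟪hA.invSqrt x, y⟫_ℂ = ⟪x, hA.invSqrt y⟫_ℂ :=
  (ContinuousLinearMap.isSelfAdjoint_iff_isSymmetric.mp hA.isSelfAdjoint_invSqrt) x y

theorem norm_invSqrt_sq (hA : IsPosDefSelfAdjoint A) (x : H) :
    ‖hA.invSqrt x‖ ^ 2 = (⟪hA.inv x, x⟫_ℂ).re := by
  rw [← hA.invSqrt_invSqrt, hA.inner_invSqrt_left]
  exact (inner_self_eq_norm_sq (𝕜 := ℂ) _).symm

theorem denseRange_invSqrt (hA : IsPosDefSelfAdjoint A) : DenseRange hA.invSqrt := by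
  have h := ContinuousLinearMap.orthogonal_ker hA.invSqrt
  rw [show hA.invSqrt.adjoint = hA.invSqrt from hA.isSelfAdjoint_invSqrt,
    show hA.invSqrt.ker = ⊥ from hA.ker_invSqrt, Submodule.bot_orthogonal_eq_top] at h
  have := (Submodule.dense_iff_topologicalClosure_eq_top).mpr h.symm
  simpa [DenseRange] using! this

/-- If `D(A) ⊆ D(B)`, then `B A⁻¹` is bounded. -/
theorem exists_inv_eq_inv_comp (hA : IsPosDefSelfAdjoint A) (hB : IsPosDefSelfAdjoint B)
    (h : A.domain ≤ B.domain) : ∃ X : H →L[ℂ] H, ∀ y, hA.inv y = hB.inv (X y) := by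
  let g : H →ₗ[ℂ] H := B.toFun ∘ₗ
    LinearMap.codRestrict B.domain (hA.inv : H →ₗ[ℂ] H) fun y => h (hA.inv_mem y)
  have hg : ∀ y, hB.inv (g y) = hA.inv y := fun y => hB.inv_apply ⟨hA.inv y, h (hA.inv_mem y)⟩
  -- Closed graph theorem; the limit is identified after applying the injective bounded operator
  -- `B⁻¹`.
  refine ⟨⟨g, g.continuous_of_seq_closed_graph fun u x y hu hgu => ?_⟩, fun y => (hg y).symm⟩
  apply hB.inv_injective
  rw [hg]
  refine tendsto_nhds_unique ((hB.inv.continuous.tendsto y).comp hgu) ?_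
  have := (hA.inv.continuous.tendsto x).comp hu
  refine this.congr fun n => ?_
  exact (hg _).symm

/-- If `D(A) ⊆ D(B)`, then `A⁻¹ ≤ c B⁻¹` for some constant `c`, by operator monotonicity of the
square root. -/
theorem exists_inv_le (hA : IsPosDefSelfAdjoint A) (hB : IsPosDefSelfAdjoint B)
    (h : A.domain ≤ B.domain) : ∃ c : ℝ, 0 ≤ c ∧ hA.inv ≤ c • hB.inv := by
  obtain ⟨X, hX⟩ := exists_inv_eq_inv_comp hA hB h
  have hX' : hA.inv = hB.inv * X := ContinuousLinearMap.ext hX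
  -- Taking adjoints moves the bounded factor to the left, so that `‖A⁻¹ x‖` is controlled by `‖B⁻¹
  -- x‖`.
  have hX'' : hA.inv = star X * hB.inv := by
    rw [← hA.isSelfAdjoint_inv.star_eq, hX', star_mul, hB.isSelfAdjoint_inv.star_eq]
  have hn : ∀ x, ‖hA.inv x‖ ≤ ‖X‖ * ‖hB.inv x‖ := by
    intro x
    rw [hX'']
    refine (ContinuousLinearMap.le_opNorm (star X) (hB.inv x)).trans_eq ?_
    rw [norm_star]
  have hc : 0 ≤ ‖X‖ • hB.inv := smul_nonneg (norm_nonneg X) hB.inv_nonneg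
  refine ⟨‖X‖, norm_nonneg X, ?_⟩
  rw [← CFC.sqrt_mul_self hA.inv hA.inv_nonneg, ← CFC.sqrt_mul_self _ hc]
  refine CFC.sqrt_le_sqrt _ _ ?_
  rw [ContinuousLinearMap.le_def, ContinuousLinearMap.isPositive_def']
  have hs := IsSelfAdjoint.of_nonneg hc
  refine ⟨?_, fun x => ?_⟩
  · refine IsSelfAdjoint.sub ?_ ?_
    · rw [← sq]; exact hs.pow 2
    · rw [← sq]; exact hA.isSelfAdjoint_inv.pow 2
  · have e : ∀ T : H →L[ℂ] H, IsSelfAdjoint T → ∀ x, (⟪(T * T) x, x⟫_ℂ).re = ‖T x‖ ^ 2 := by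
      intro T hT x
      have h : ⟪T (T x), x⟫_ℂ = ⟪T x, T x⟫_ℂ :=
        ContinuousLinearMap.isSelfAdjoint_iff_isSymmetric.mp hT (T x) x
      rw [mul_apply_eq_comp, h]
      exact inner_self_eq_norm_sq (𝕜 := ℂ) _
    rw [ContinuousLinearMap.reApplyInnerSelf_apply, sub_apply, inner_sub_left,
      map_sub]
    change 0 ≤ (⟪_, x⟫_ℂ).re - (⟪_, x⟫_ℂ).re
    rw [e _ hs, e _ hA.isSelfAdjoint_inv, sub_nonneg]
    refine pow_le_pow_left₀ (norm_nonneg _) ?_ 2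
    rw [smul_apply, norm_smul, norm_norm]
    exact hn x

/-- If `D(A) ⊆ D(B)`, then `A^{-1/2} = B^{-1/2} C` for some bounded `C`. -/
theorem exists_invSqrt_eq_invSqrt_comp (hA : IsPosDefSelfAdjoint A) (hB : IsPosDefSelfAdjoint B)
    (h : A.domain ≤ B.domain) : ∃ C : H →L[ℂ] H, hA.invSqrt = hB.invSqrt * C := by
  obtain ⟨c, hc, hle⟩ := exists_inv_le hA hB h
  have hn : ∀ x, ‖(hA.invSqrt : H →ₗ[ℂ] H) x‖ ≤ √c * ‖(hB.invSqrt : H →ₗ[ℂ] H) x‖ := by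
    intro x
    refine pow_le_pow_iff_left₀ (norm_nonneg _) (by positivity) two_ne_zero |>.mp ?_
    rw [mul_pow, Real.sq_sqrt hc]
    change ‖hA.invSqrt x‖ ^ 2 ≤ c * ‖hB.invSqrt x‖ ^ 2
    rw [hA.norm_invSqrt_sq, hB.norm_invSqrt_sq]
    have := ((ContinuousLinearMap.isPositive_def'.mp
      ((ContinuousLinearMap.le_def _ _).mp hle)).2 x)
    rw [ContinuousLinearMap.reApplyInnerSelf_apply, sub_apply, inner_sub_left,
      map_sub, smul_apply, inner_smul_left_eq_star_smul] at this
    simpa using this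
  -- `D` extends `B^{-1/2} x ↦ A^{-1/2} x` from the dense range of `B^{-1/2}`; its adjoint is the
  -- required factor.
  let D : H →L[ℂ] H := (hA.invSqrt : H →ₗ[ℂ] H).extendOfNorm (hB.invSqrt : H →ₗ[ℂ] H)
  have hD : hA.invSqrt = D * hB.invSqrt := by
    ext x
    exact (LinearMap.extendOfNorm_eq hB.denseRange_invSqrt ⟨_, hn⟩ x).symm
  refine ⟨star D, ?_⟩
  rw [← hA.isSelfAdjoint_invSqrt.star_eq, hD, star_mul, hB.isSelfAdjoint_invSqrt.star_eq]

/-- The factorization puts the range of `A^{-1/2}` inside that of `B^{-1/2}`, the domain of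
`B^{1/2}`, so the product is everywhere defined. -/
theorem toPMap_eq_opComp_sqrt_invSqrt (hA : IsPosDefSelfAdjoint A) (hB : IsPosDefSelfAdjoint B)
    {C : H →L[ℂ] H} (hC : hA.invSqrt = hB.invSqrt * C) :
    (C : H →ₗ[ℂ] H).toPMap ⊤ = opComp hB.sqrt ((hA.invSqrt : H →ₗ[ℂ] H).toPMap ⊤) := by
  have hker : ((hB.invSqrt : H →ₗ[ℂ] H).toPMap ⊤).toFun.ker = ⊥ := by
    rw [LinearMap.ker_eq_bot]
    intro x y hxy
    exact Subtype.ext (hB.invSqrt_injective hxy)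
  have hCx : ∀ x, hA.invSqrt x = hB.invSqrt (C x) := fun x => by rw [hC]; rfl
  refine LinearPMap.ext ?_ ?_
  · symm
    rw [LinearMap.toPMap_domain, eq_top_iff]
    intro x _
    refine ⟨⟨x, trivial⟩, ?_, rfl⟩
    change hA.invSqrt x ∈ hB.sqrt.domain
    rw [sqrt, LinearPMap.inverse_domain]
    exact ⟨⟨C x, trivial⟩, (hCx x).symm⟩
  · intro x _ _
    symm
    exact LinearPMap.inverse_apply_eq hker (x := ⟨C x, trivial⟩) (hCx x).symm

theorem energyNorm_eq (hA : IsPosDefSelfAdjoint A) (x : A.domain) :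
    energyNorm A x = ‖hA.invSqrt (A x)‖ := by
  rw [energyNorm, ← Real.sqrt_sq (norm_nonneg (hA.invSqrt (A x))), norm_invSqrt_sq, inv_apply,
    ← inner_conj_symm, Complex.conj_re]

/-- The energy norm of `A` is bounded by that of `B` with constant `‖A^{1/2} B^{-1/2}‖`. -/
theorem energyNorm_le (hA : IsPosDefSelfAdjoint A) (hB : IsPosDefSelfAdjoint B)
    {C : H →L[ℂ] H} (hC : hB.invSqrt = hA.invSqrt * C) (x : A.domain) (hx : (x : H) ∈ B.domain) :
    energyNorm A x ≤ ‖C‖ * energyNorm B ⟨x, hx⟩ := by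
  rw [hA.energyNorm_eq, hB.energyNorm_eq]
  have h : hA.invSqrt (A x) = C (hB.invSqrt (B ⟨x, hx⟩)) := by
    apply hA.invSqrt_injective
    rw [hA.invSqrt_invSqrt, hA.inv_apply, ← mul_apply_eq_comp, ← hC,
      hB.invSqrt_invSqrt, hB.inv_apply]
  rw [h]
  exact C.le_opNorm _

/-- The two factors satisfy `C₁ C₂ = 1`, as injectivity of `B^{-1/2}` shows. -/
theorem one_le_norm_mul_norm [Nontrivial H] (hA : IsPosDefSelfAdjoint A)
    (hB : IsPosDefSelfAdjoint B)
    {C₁ C₂ : H →L[ℂ] H} (h₁ : hA.invSqrt = hB.invSqrt * C₁) (h₂ : hB.invSqrt = hA.invSqrt * C₂) :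
    1 ≤ ‖C₁‖ * ‖C₂‖ := by
  have : C₁ * C₂ = 1 := by
    ext x
    apply hB.invSqrt_injective
    rw [← mul_apply_eq_comp hB.invSqrt, ← mul_assoc, ← h₁, ← h₂]
    rfl
  calc (1 : ℝ) = ‖C₁ * C₂‖ := by rw [this, norm_one]
    _ ≤ _ := norm_mul_le _ _

/-- Completing the square: minimizing the functional is minimizing the energy distance to the
solution. -/
theorem ritzFunctional_eq (hA : IsPosDefSelfAdjoint A) (x z : A.domain) :
    ritzFunctional A (A x) z = energyNorm A (x - z) ^ 2 - energyNorm A x ^ 2 := by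
  have hnn : ∀ u : A.domain, 0 ≤ (⟪A u, (u : H)⟫_ℂ).re := by
    intro u
    obtain ⟨γ, hγ, hb⟩ := hA.lower_bound
    exact le_trans (by positivity) (hb u)
  rw [energyNorm, energyNorm, Real.sq_sqrt (hnn _), Real.sq_sqrt (hnn _), ritzFunctional,
    LinearPMap.map_sub, Submodule.coe_sub, inner_sub_left, inner_sub_right, inner_sub_right]
  have : (⟪A z, (x : H)⟫_ℂ).re = (⟪A x, (z : H)⟫_ℂ).re := by
    rw [hA.symm, ← inner_conj_symm, Complex.conj_re]
  simp only [Complex.sub_re]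
  linarith

/-- The Ritz approximation is the best approximation in the energy norm. -/
theorem energyNorm_sub_le_of_isRitzSolution (hA : IsPosDefSelfAdjoint A) {x z : A.domain}
    {e : ℕ → H} {n : ℕ} (hz : IsRitzSolution A (A x) e n z) {w : A.domain}
    (hw : (w : H) ∈ Submodule.span ℂ (e '' Set.Iio n)) :
    energyNorm A (x - z) ≤ energyNorm A (x - w) := by
  have h : ritzFunctional A (A x) z ≤ ritzFunctional A (A x) w := hz.2 hw
  rw [hA.ritzFunctional_eq, hA.ritzFunctional_eq] at h
  have h' : energyNorm A (x - z) ^ 2 ≤ energyNorm A (x - w) ^ 2 := by linarith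
  exact pow_le_pow_iff_left₀ (Real.sqrt_nonneg _) (Real.sqrt_nonneg _) two_ne_zero |>.mp h'

end IsPosDefSelfAdjoint

end PositiveDefinite

/-! ### Eigenbasis expansions and the Jackson inequality -/

namespace SimpleDiscreteSpectrum

variable {B : H →ₗ.[ℂ] H} (S : SimpleDiscreteSpectrum B)

theorem hasSum_norm_repr_sq (x : H) : HasSum (fun j => ‖S.basis.repr x j‖ ^ 2) (‖x‖ ^ 2) := by
  have := lp.hasSum_norm (p := 2) (by norm_num) (S.basis.repr x)
  simpa [LinearIsometryEquiv.norm_map] using this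

theorem repr_func (G : ℝ → ℂ) (x : (S.func G).domain) (j : ℕ) :
    S.basis.repr (S.func G x) j = G (S.eigenvalue j) * S.basis.repr (x : H) j := by
  change S.basis.repr (S.basis.repr.symm (S.funcCoeff G x)) j = _
  rw [LinearIsometryEquiv.apply_symm_apply]
  rfl

theorem repr_power (s : ℝ) (x : (S.power s).domain) (j : ℕ) :
    S.basis.repr (S.power s x) j = ((S.eigenvalue j ^ s : ℝ) : ℂ) * S.basis.repr (x : H) j :=
  S.repr_func _ x j

theorem repr_unitaryGroup (h : ℝ) (x : H) (j : ℕ) :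
    S.basis.repr (S.unitaryGroup h x) j =
      Complex.exp (h * S.eigenvalue j * Complex.I) * S.basis.repr x j :=
  S.repr_func _ ⟨x, S.mem_exp_domain h x⟩ j

theorem repr_diff (k : ℕ) (h : ℝ) (x : H) (j : ℕ) :
    S.basis.repr (S.diff k h x) j =
      (Complex.exp (h * S.eigenvalue j * Complex.I) - 1) ^ k * S.basis.repr x j := by
  induction k with
  | zero => simp [diff]
  | succ k ih =>
    have : S.diff (k + 1) h x = S.unitaryGroup h (S.diff k h x) - S.diff k h x := by
      rw [diff, pow_succ']
      rfl
    rw [this, map_sub, lp.coeFn_sub, Pi.sub_apply, repr_unitaryGroup, ih]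
    ring

theorem norm_exp_mul_I_sub_one_sq (θ : ℝ) :
    ‖Complex.exp (θ * Complex.I) - 1‖ ^ 2 = 2 * (1 - Real.cos θ) := by
  rw [Complex.exp_mul_I, ← Complex.ofReal_cos, ← Complex.ofReal_sin, Complex.sq_norm,
    Complex.normSq_apply]
  simp only [Complex.sub_re, Complex.add_re, Complex.mul_re, Complex.ofReal_re, Complex.I_re,
    Complex.ofReal_im, Complex.I_im, Complex.one_re, Complex.sub_im, Complex.add_im, Complex.mul_im,
    Complex.one_im]
  linear_combination Real.sin_sq_add_cos_sq θ

theorem hasSum_norm_diff_sq (k : ℕ) (h : ℝ) (x : H) :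
    HasSum (fun j => (2 * (1 - Real.cos (h * S.eigenvalue j))) ^ k * ‖S.basis.repr x j‖ ^ 2)
      (‖S.diff k h x‖ ^ 2) := by
  convert S.hasSum_norm_repr_sq (S.diff k h x) using 2 with j
  rw [← norm_exp_mul_I_sub_one_sq, Complex.ofReal_mul, repr_diff, norm_mul, norm_pow]
  ring

/-- This crude bound makes the supremum defining the modulus finite. -/
theorem norm_diff_le (k : ℕ) (h : ℝ) (x : H) : ‖S.diff k h x‖ ≤ 2 ^ k * ‖x‖ := by
  refine pow_le_pow_iff_left₀ (norm_nonneg _) (by positivity) two_ne_zero |>.mp ?_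
  rw [mul_pow]
  refine hasSum_le (fun j => ?_) (S.hasSum_norm_diff_sq k h x)
    ((S.hasSum_norm_repr_sq x).mul_left _)
  refine mul_le_mul_of_nonneg_right ?_ (sq_nonneg _)
  rw [← pow_mul, mul_comm k 2, pow_mul]
  refine pow_le_pow_left₀ ?_ ?_ _
  · linarith [Real.cos_le_one (h * S.eigenvalue j)]
  · linarith [Real.neg_one_le_cos (h * S.eigenvalue j)]

theorem norm_diff_le_modulus (k : ℕ) {t τ : ℝ} (h0 : 0 < τ) (h1 : τ ≤ t) (x : H) :
    ‖S.diff k τ x‖ ≤ S.modulus k t x :=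
  le_ciSup (f := fun τ : Set.Ioc (0 : ℝ) t => ‖S.diff k τ x‖)
    ⟨2 ^ k * ‖x‖, by rintro _ ⟨τ, rfl⟩; exact S.norm_diff_le k τ x⟩ ⟨τ, h0, h1⟩

theorem modulus_nonneg (k : ℕ) (t : ℝ) (x : H) : 0 ≤ S.modulus k t x :=
  Real.iSup_nonneg fun _ => norm_nonneg _

/-- A Jackson inequality: the mass of `u` on the spectrum above `λ_n` is controlled by the `k`-th
modulus of continuity at `π / λ_n`. -/
theorem sum_norm_repr_sq_le_modulus (k n : ℕ) (hn : 0 < S.eigenvalue n) (u : H) (F : Finset ℕ)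
    (hF : ∀ j ∈ F, n ≤ j) :
    ∑ j ∈ F, ‖S.basis.repr u j‖ ^ 2 ≤
      (√(k + 1) / 2 ^ k * S.modulus k (Real.pi / S.eigenvalue n) u) ^ 2 := by
  set σ := S.eigenvalue n
  set ω := S.modulus k (Real.pi / σ) u
  have hpt : ∀ t ∈ Set.Icc 0 Real.pi,
      ∑ j ∈ F, 2 ^ k * ‖S.basis.repr u j‖ ^ 2 *
        ((1 - Real.cos (S.eigenvalue j / σ * t)) ^ k * Real.sin t) ≤ ω ^ 2 * Real.sin t := by
    rintro t ⟨h0, h1⟩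
    have hsin := Real.sin_nonneg_of_nonneg_of_le_pi h0 h1
    -- The modulus only covers positive steps; at `t = 0` the weight `sin t` vanishes.
    rcases h0.eq_or_lt with rfl | h0
    · simp
    have h2 : ‖S.diff k (t / σ) u‖ ≤ ω :=
      S.norm_diff_le_modulus k (by positivity) (by gcongr) u
    have h3 : ∑ j ∈ F, (2 * (1 - Real.cos (t / σ * S.eigenvalue j))) ^ k *
        ‖S.basis.repr u j‖ ^ 2 ≤ ω ^ 2 :=
      (sum_le_hasSum F (fun j _ => mul_nonneg (pow_nonneg (by
        linarith [Real.cos_le_one (t / σ * S.eigenvalue j)]) _) (sq_nonneg _))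
        (S.hasSum_norm_diff_sq k (t / σ) u)).trans (pow_le_pow_left₀ (norm_nonneg _) h2 2)
    refine le_trans (le_of_eq ?_) (mul_le_mul_of_nonneg_right h3 hsin)
    rw [Finset.sum_mul]
    refine Finset.sum_congr rfl fun j _ => ?_
    rw [mul_pow, show t / σ * S.eigenvalue j = S.eigenvalue j / σ * t by ring]
    ring
  have hint := intervalIntegral.integral_mono_on (μ := MeasureTheory.volume) Real.pi_pos.le
    (Continuous.intervalIntegrable (by fun_prop) _ _)
    (Continuous.intervalIntegrable (by fun_prop) _ _) hpt
  rw [intervalIntegral.integral_finsetSum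
    (fun j _ => Continuous.intervalIntegrable (by fun_prop) _ _)] at hint
  simp only [intervalIntegral.integral_const_mul, integral_sin, Real.cos_zero, Real.cos_pi] at hint
  -- The factor `1 - -1` is `∫₀^π sin t dt = 2`, which cancels one power of two and leaves `(k + 1)
  -- / 4 ^ k`.
  have hlow : ∑ j ∈ F, 2 ^ k * ‖S.basis.repr u j‖ ^ 2 * (2 ^ (k + 1) / (k + 1)) ≤
      ω ^ 2 * (1 - -1) := by
    refine le_trans (Finset.sum_le_sum fun j hj => ?_) hint
    refine mul_le_mul_of_nonneg_left (le_sineMoment ?_ k) (by positivity)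
    rw [one_le_div hn]
    exact S.strictMono.monotone (hF j hj)
  rw [← Finset.sum_mul, ← Finset.mul_sum] at hlow
  rw [mul_pow, div_pow, Real.sq_sqrt (by positivity), div_mul_eq_mul_div, le_div_iff₀ (by positivity)]
  rw [mul_div_assoc', div_le_iff₀ (by positivity)] at hlow
  rw [pow_succ] at hlow
  nlinarith

theorem tendsto_norm_sq_sub_sum (u : H) :
    Tendsto (fun n => ‖u‖ ^ 2 - ∑ j ∈ Finset.range n, ‖S.basis.repr u j‖ ^ 2) atTop (𝓝 0) := by
  have h := (S.hasSum_norm_repr_sq u).tendsto_sum_nat.const_sub (‖u‖ ^ 2)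
  rwa [sub_self] at h

theorem sum_norm_repr_sq_le_sub (n : ℕ) (u : H) (F : Finset ℕ) (hF : ∀ j ∈ F, n ≤ j) :
    ∑ j ∈ F, ‖S.basis.repr u j‖ ^ 2 ≤
      ‖u‖ ^ 2 - ∑ j ∈ Finset.range n, ‖S.basis.repr u j‖ ^ 2 := by
  have hd : Disjoint F (Finset.range n) := by
    rw [Finset.disjoint_left]
    intro j hj hj'
    exact absurd (Finset.mem_range.mp hj') (not_lt.mpr (hF j hj))
  rw [le_sub_iff_add_le, ← Finset.sum_union hd]
  exact sum_le_hasSum _ (fun _ _ => sq_nonneg _) (S.hasSum_norm_repr_sq u)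

/-- The partial sums of the expansion in the eigenbasis. -/
def partialSum (n : ℕ) (x : H) : H := ∑ j ∈ Finset.range n, S.basis.repr x j • S.basis j

theorem partialSum_mem_span (n : ℕ) (x : H) :
    S.partialSum n x ∈ Submodule.span ℂ (S.basis '' Set.Iio n) :=
  Submodule.sum_mem _ fun j hj => Submodule.smul_mem _ _
    (Submodule.subset_span ⟨j, Finset.mem_range.mp hj, rfl⟩)

theorem partialSum_mem_domain (n : ℕ) (x : H) : S.partialSum n x ∈ B.domain :=
  Submodule.sum_mem _ fun j _ => Submodule.smul_mem _ _ (S.basis_mem j)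

theorem repr_sub_partialSum (n : ℕ) (x : H) (j : ℕ) :
    S.basis.repr (x - S.partialSum n x) j = if n ≤ j then S.basis.repr x j else 0 := by
  classical
  rw [map_sub, lp.coeFn_sub, Pi.sub_apply, S.basis.repr_apply_apply (S.partialSum n x), partialSum,
    inner_sum]
  simp_rw [inner_smul_right, orthonormal_iff_ite.mp S.basis.orthonormal]
  simp only [mul_ite, mul_one, mul_zero, Finset.sum_ite_eq, Finset.mem_range]
  split_ifs <;> first | omega | simp

section PositiveDefinite

variable [CompleteSpace H]

theorem eigenvalue_pos (hB : IsPosDefSelfAdjoint B) (n : ℕ) : 0 < S.eigenvalue n := by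
  obtain ⟨γ, hγ, hb⟩ := hB.lower_bound
  have h := hb ⟨S.basis n, S.basis_mem n⟩
  have h1 : ‖S.basis n‖ = 1 := S.basis.orthonormal.1 n
  rw [S.apply_basis, inner_smul_left, inner_self_eq_norm_sq_to_K, h1] at h
  simp only [Complex.conj_ofReal] at h
  norm_num at h
  linarith

theorem hasSum_energyNorm_sq (hB : IsPosDefSelfAdjoint B) (x : B.domain) :
    HasSum (fun j => S.eigenvalue j * ‖S.basis.repr (x : H) j‖ ^ 2) (energyNorm B x ^ 2) := by
  have hnn : 0 ≤ (⟪B x, (x : H)⟫_ℂ).re := by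
    obtain ⟨γ, hγ, hb⟩ := hB.lower_bound
    exact le_trans (by positivity) (hb x)
  rw [energyNorm, Real.sq_sqrt hnn]
  have h := Complex.reCLM.hasSum (S.basis.hasSum_inner_mul_inner (B x) (x : H))
  refine h.congr_fun fun j => ?_
  have e : ⟪B x, S.basis j⟫_ℂ = S.eigenvalue j * ⟪(x : H), S.basis j⟫_ℂ := by
    rw [hB.symm x ⟨S.basis j, S.basis_mem j⟩, S.apply_basis, inner_smul_right]
  rw [S.basis.repr_apply_apply]
  simp only [Complex.reCLM_apply]
  rw [e, mul_assoc, Complex.re_ofReal_mul, ← inner_conj_symm (x : H), ← Complex.normSq_eq_conj_mul_self,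
    Complex.ofReal_re, Complex.normSq_eq_norm_sq]

/-- If the mass of `B ^ α x` on the spectrum above `λ_n` is at most `M ^ 2`, then the energy norm of
the corresponding part of `x` is at most `M / λ_n ^ (α - 1/2)`. -/
theorem energyNorm_sub_partialSum_le (hB : IsPosDefSelfAdjoint B) {α : ℝ} (hα : 1 / 2 ≤ α)
    (x : B.domain) (hx : (x : H) ∈ (S.power α).domain) (n : ℕ) {M : ℝ} (hM : 0 ≤ M)
    (h : ∀ F : Finset ℕ, (∀ j ∈ F, n ≤ j) →
      ∑ j ∈ F, ‖S.basis.repr (S.power α ⟨x, hx⟩) j‖ ^ 2 ≤ M ^ 2) :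
    S.eigenvalue n ^ (α - 1 / 2) *
      energyNorm B (x - ⟨S.partialSum n x, S.partialSum_mem_domain n x⟩) ≤ M := by
  have hn := S.eigenvalue_pos hB n
  refine pow_le_pow_iff_left₀ (mul_nonneg (by positivity) (Real.sqrt_nonneg _)) hM
    two_ne_zero |>.mp ?_
  rw [mul_pow]
  refine hasSum_le_of_sum_le ((S.hasSum_energyNorm_sq hB _).mul_left _) fun F => ?_
  refine le_trans ?_ (h (F.filter (n ≤ ·)) (by simp))
  rw [Finset.sum_filter]
  refine Finset.sum_le_sum fun j _ => ?_
  rw [Submodule.coe_sub, repr_sub_partialSum]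
  split_ifs with hj
  · rw [repr_power, norm_mul, mul_pow, ← mul_assoc]
    refine mul_le_mul_of_nonneg_right ?_ (sq_nonneg _)
    have hjp := S.eigenvalue_pos hB j
    rw [Complex.norm_real, Real.norm_of_nonneg (by positivity)]
    -- Since `α ≥ 1/2`, replacing `λ_n` by the larger `λ_j` increases the power.
    calc (S.eigenvalue n ^ (α - 1 / 2)) ^ 2 * S.eigenvalue j
        ≤ (S.eigenvalue j ^ (α - 1 / 2)) ^ 2 * S.eigenvalue j := by
          gcongr
          exact S.strictMono.monotone hj
      _ = (S.eigenvalue j ^ α) ^ 2 := by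
          rw [Real.rpow_sub hjp, div_pow, ← Real.sqrt_eq_rpow, Real.sq_sqrt hjp.le]
          field_simp
  · simp

end PositiveDefinite

end SimpleDiscreteSpectrum

end RitzApprox

/-! ### The error estimate and the limit -/

open RitzApprox in
theorem mainTheorem4 {H : Type*} [NormedAddCommGroup H] [InnerProductSpace ℂ H] [CompleteSpace H]
    (A B : H →ₗ.[ℂ] H)
    (hA : IsPosDefSelfAdjoint A) (hB : IsPosDefSelfAdjoint B)
    (S : SimpleDiscreteSpectrum B) (hAB : A.domain = B.domain) :
    ∃ C₁ C₂ : H →L[ℂ] H,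
      (C₁ : H →ₗ[ℂ] H).toPMap ⊤ = opComp hB.sqrt ((hA.invSqrt : H →ₗ[ℂ] H).toPMap ⊤) ∧
      (C₂ : H →ₗ[ℂ] H).toPMap ⊤ = opComp hA.sqrt ((hB.invSqrt : H →ₗ[ℂ] H).toPMap ⊤) ∧
      ∀ (α : ℝ), 1 ≤ α →
      ∀ (y : H) (x : A.domain), A x = y →
      ∀ (hx : (x : H) ∈ (S.power α).domain) (z : ℕ → A.domain),
        (∀ n, IsRitzSolution A y S.basis n (z n)) →
        (∀ k : ℕ, 1 ≤ k → ∀ n : ℕ,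
          energyNorm A (x - z n) ≤
            ‖C₂‖ * (‖C₁‖ * ‖C₂‖) * (√(k + 1) / (2 ^ k * S.eigenvalue n ^ (α - 1 / 2))) *
              S.modulus k (Real.pi / S.eigenvalue n) (S.power α ⟨x, hx⟩)) ∧
        Tendsto (fun n => S.eigenvalue n ^ (α - 1 / 2) * energyNorm A (x - z n)) atTop (𝓝 0) := by
  obtain ⟨C₁, h₁⟩ := hA.exists_invSqrt_eq_invSqrt_comp hB hAB.le
  obtain ⟨C₂, h₂⟩ := hB.exists_invSqrt_eq_invSqrt_comp hA hAB.ge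
  refine ⟨C₁, C₂, hA.toPMap_eq_opComp_sqrt_invSqrt hB h₁, hB.toPMap_eq_opComp_sqrt_invSqrt hA h₂, ?_⟩
  rintro α hα y x rfl hx z hz
  have : Nontrivial H := ⟨S.basis 0, 0, S.basis.orthonormal.ne_zero 0⟩
  have hC := hA.one_le_norm_mul_norm hB h₁ h₂
  have hpos : ∀ n, 0 < S.eigenvalue n ^ (α - 1 / 2) := fun n =>
    Real.rpow_pos_of_pos (S.eigenvalue_pos hB n) _
  -- Both conclusions follow from one bound in terms of any `M` dominating the tail norm of `u`.
  -- Eigenvalues are numbered from `0`, so `S.eigenvalue n` is the `λ_{n+1}` of the statement.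
  set u := S.power α ⟨x, hx⟩
  have hmain : ∀ (n : ℕ) (M : ℝ), 0 ≤ M →
      (∀ F : Finset ℕ, (∀ j ∈ F, n ≤ j) → ∑ j ∈ F, ‖S.basis.repr u j‖ ^ 2 ≤ M ^ 2) →
      S.eigenvalue n ^ (α - 1 / 2) * energyNorm A (x - z n) ≤ ‖C₂‖ * M := by
    intro n M hM hF
    let w : A.domain := ⟨S.partialSum n x, hAB.ge (S.partialSum_mem_domain n x)⟩
    have e₁ := hA.energyNorm_sub_le_of_isRitzSolution (hz n) (w := w) (S.partialSum_mem_span n x)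
    have e₂ := hA.energyNorm_le hB h₂ (x - w) (hAB.le (x - w).2)
    have e₃ := S.energyNorm_sub_partialSum_le hB (by linarith) ⟨x, hAB.le x.2⟩ hx n hM hF
    calc S.eigenvalue n ^ (α - 1 / 2) * energyNorm A (x - z n)
        ≤ S.eigenvalue n ^ (α - 1 / 2) * (‖C₂‖ * energyNorm B ⟨x - w, hAB.le (x - w).2⟩) :=
          mul_le_mul_of_nonneg_left (e₁.trans e₂) (hpos n).le
      _ = ‖C₂‖ * (S.eigenvalue n ^ (α - 1 / 2) * energyNorm B ⟨x - w, hAB.le (x - w).2⟩) := by ring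
      _ ≤ ‖C₂‖ * M := mul_le_mul_of_nonneg_left e₃ (norm_nonneg _)
  refine ⟨fun k _ n => ?_, ?_⟩
  · have hω := S.modulus_nonneg k (Real.pi / S.eigenvalue n) u
    have hM : 0 ≤ √(k + 1) / 2 ^ k * S.modulus k (Real.pi / S.eigenvalue n) u := by positivity
    have h := hmain n _ hM (S.sum_norm_repr_sq_le_modulus k n (S.eigenvalue_pos hB n) u)
    have hpos' := (hpos n).ne'
    refine le_of_mul_le_mul_left (h.trans ?_) (hpos n)
    -- The constant `‖C₂‖` alone suffices; the extra factor is at least `1`.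
    calc _ ≤ ‖C₂‖ * (‖C₁‖ * ‖C₂‖) *
          (√(k + 1) / 2 ^ k * S.modulus k (Real.pi / S.eigenvalue n) u) :=
          mul_le_mul_of_nonneg_right (le_mul_of_one_le_right (norm_nonneg _) hC) hM
      _ = _ := by
          generalize S.eigenvalue n ^ (α - 1 / 2) = c at hpos'
          field_simp
  · have ht : Tendsto (fun n => ‖C₂‖ *
        √(‖u‖ ^ 2 - ∑ j ∈ Finset.range n, ‖S.basis.repr u j‖ ^ 2)) atTop (𝓝 0) := by
      simpa using (S.tendsto_norm_sq_sub_sum u).sqrt.const_mul ‖C₂‖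
    refine squeeze_zero (fun n => mul_nonneg (hpos n).le (Real.sqrt_nonneg _)) (fun n => ?_) ht
    refine hmain n _ (Real.sqrt_nonneg _) fun F hF => ?_
    -- The empty set `F` gives nonnegativity of the tail mass.
    rw [Real.sq_sqrt (by simpa using S.sum_norm_repr_sq_le_sub n u ∅ (by simp))]
    exact S.sum_norm_repr_sq_le_sub n u F hF

end
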